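/- Let $\mathbb R^J$ be the standard Euclidean space and let $f\colon\mathbb R^J\to\left]-\infty,+\infty\right]$ be a convex function of Legendre type. That is, with $\operatorname{dom} f=\{x : f(x)\in\mathbb R\}$ and $U=\operatorname{int}\operatorname{dom} f$: $f$ is differentiable on $U$; $\|\nabla f(x)\|\to+\infty$ whenever $x\in U$ approaches a boundary point of $\operatorname{dom} f$; and $f$ is strictly convex on every convex subset of $\operatorname{dom}\partial f=\{x\in\operatorname{dom} f : \partial f(x)\neq\varnothing\}$. Let $f^*(u)=\sup_{x\in\mathbb R^J}\big(\langle x,u\rangle-f(x)\big)$ be the Fenchel conjugate of $f$, and let the Bregman distance be \[ D(x,y)=\begin{cases} f(x)-f(y)-\langle\nabla f(y),x-y\rangle, & y\in U,\\ +\infty, & y\notin U.\end{cases} \] Let $C$ be a nonempty compact subset of $U$. For $x\in\mathbb R^J$ put $F_C(x)=\sup_{c\in C}D(x,c)$, and let $\Phi_C(x)=\{c\in C : D(x,c)=F_C(x)\}$ if $x\in\operatorname{dom} f$ and $\Phi_C(x)=\varnothing$ otherwise. Then $F_C$ has a unique minimizer over $\mathbb R^J$, called the $D$-Chebyshev center of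 $C$, and this minimizer lies in $U$. It is characterized as follows: a point $x\in\mathbb R^J$ is the $D$-Chebyshev center of $C$ if and only if \[ x\in\nabla f^*\Big(\operatorname{conv}\nabla f\big(\Phi_C(x)\big)\Big). \] -/

import Mathlib

open Set Filter Topology

noncomputable section

namespace Bregman

/-- The standard Euclidean space `ℝ^J`. -/
abbrev E (J : ℕ) : Type := EuclideanSpace ℝ (Fin J)

/-- The (essential) domain of an extended-real-valued function: the points with a real value. -/
def dom {J : ℕ} (g : E J → EReal) : Set (E J) := {x | g x ≠ ⊥ ∧ g x ≠ ⊤}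

/-- The real-valued function that agrees with `g` on `dom g`; only used at points of `dom g`. -/
def re {J : ℕ} (g : E J → EReal) : E J → ℝ := fun x => (g x).toReal

/-- The gradient `∇ g (x)`; only used at points `x` of the interior of `dom g`. -/
def grad {J : ℕ} (g : E J → EReal) (x : E J) : E J := gradient (re g) x

/-- The image `∇ g (S)`: the gradients of `g` at those points of `S` that are interior to `dom g`
and at which `g` is differentiable. -/
def gradImage {J : ℕ} (g : E J → EReal) (S : Set (E J)) : Set (E J) :=
  {v | ∃ u ∈ S, u ∈ interior (dom g) ∧ HasGradientAt (re g) v u}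

/-- The subdifferential `∂ g (x)`, empty outside `dom g`. -/
def subdiff {J : ℕ} (g : E J → EReal) (x : E J) : Set (E J) :=
  {u | x ∈ dom g ∧ ∀ h : E J, g x + ((inner ℝ h u : ℝ) : EReal) ≤ g (x + h)}

/-- Convexity of a function with values in `]-∞, +∞]`. -/
structure IsConvex {J : ℕ} (g : E J → EReal) : Prop where
  ne_bot : ∀ x, g x ≠ ⊥
  convexOn : ConvexOn ℝ (dom g) (re g)

/-- Essential smoothness. -/
structure EssSmooth {J : ℕ} (g : E J → EReal) : Prop where
  differentiable : ∀ x ∈ interior (dom g), DifferentiableAt ℝ (re g) x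
  blowup : ∀ b ∈ frontier (dom g),
    Tendsto (fun x => ‖grad g x‖) (𝓝[interior (dom g)] b) atTop

/-- Essential strict convexity: strict convexity on every convex subset of `dom ∂ g`. -/
def EssStrictConvex {J : ℕ} (g : E J → EReal) : Prop :=
  ∀ S : Set (E J), S ⊆ {x | (subdiff g x).Nonempty} → Convex ℝ S → StrictConvexOn ℝ S (re g)

/-- Convex functions of Legendre type. -/
structure IsLegendre {J : ℕ} (g : E J → EReal) : Prop where
  convex : IsConvex g
  smooth : EssSmooth g
  strict : EssStrictConvex g

/-- The Fenchel conjugate `g*`. -/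
def conj {J : ℕ} (g : E J → EReal) (u : E J) : EReal :=
  ⨆ x : E J, ((inner ℝ x u : ℝ) : EReal) - g x

open Classical in
/-- The Bregman distance `D(x, y)` with respect to `f`. -/
def D {J : ℕ} (f : E J → EReal) (x y : E J) : EReal :=
  if y ∈ interior (dom f) then f x - f y - ((inner ℝ (grad f y) (x - y) : ℝ) : EReal) else ⊤

/-- The right Bregman farthest-distance function `F_C`. -/
def farDist {J : ℕ} (f : E J → EReal) (C : Set (E J)) (x : E J) : EReal :=
  ⨆ c ∈ C, D f x c

/-- The right Bregman farthest-point map `Φ_C`, empty outside `dom f`. -/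
def farPts {J : ℕ} (f : E J → EReal) (C : Set (E J)) (x : E J) : Set (E J) :=
  {c | x ∈ dom f ∧ c ∈ C ∧ D f x c = farDist f C x}

/-- The set of global minimizers over `ℝ^J`. -/
def argmin {J : ℕ} (g : E J → EReal) : Set (E J) := {x | ∀ y, g x ≤ g y}

end Bregman

end

/-!
The farthest-distance function `F_C` is, on `dom f`, the maximum over `c ∈ C` of the functions
`f - f c - ⟪∇ f c, · - c⟫`, which differ from `f` by affine functions. Three properties of a Legendre
function `f` on `ℝ^J` carry the proof.

* At a boundary point of `dom f` the gradients blow up and point outwards, so a step towards an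
  interior point decreases `f` by a definite amount, even after adding a bounded linear form
  (`exists_descent_near_frontier`). Hence a minimizing sequence of `F_C` cannot approach the
  boundary. This replaces lower semicontinuity of `f`, which is not assumed.
* By strict convexity `f` grows at least linearly above each of its tangent planes at interior
  points (`exists_linear_growth`). Hence minimizing sequences of `F_C` are bounded, and a minimizer
  exists, lies in the interior of `dom f`, and is unique by strict convexity.
* `∇ f*` inverts `∇ f`: the growth estimate shows that `f*` is differentiable at `∇ f (x)` with
  gradient `x` (`IsLegendre.hasGradientAt_conj`); conversely, if `∇ f* (u) = x`, then maximizing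
  sequences of `⟪·, u⟫ - f` converge to `x`, which is interior by the descent property, and
  `u = ∇ f (x)` (`IsLegendre.mem_interior_of_hasGradientAt_conj`).

The characterization thereby becomes `∇ f (x) ∈ conv ∇ f (Φ_C (x))`, the rule for the
subdifferential of a maximum: necessity is a separation argument using that the hull is compact
(`grad_mem_convexHull`), and sufficiency is the gradient inequality
(`mem_argmin_of_grad_mem_convexHull`).
-/

namespace Bregman

/-! ### Convex hulls of compact sets -/

/-- By Carathéodory, the hull is a finite union of continuous images of the compact sets
`stdSimplex × s ^ k`, `k ≤ dim + 1`. -/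
theorem isCompact_convexHull {V : Type*} [NormedAddCommGroup V] [NormedSpace ℝ V]
    [FiniteDimensional ℝ V] {s : Set V} (hs : IsCompact s) : IsCompact (convexHull ℝ s) := by
  have key : convexHull ℝ s = ⋃ k ∈ Finset.range (Module.finrank ℝ V + 2),
      (fun p : (Fin k → ℝ) × (Fin k → V) => ∑ i, p.1 i • p.2 i) ''
        (stdSimplex ℝ (Fin k) ×ˢ Set.pi univ fun _ => s) := by
    apply Subset.antisymm
    · intro x hx
      rw [convexHull_eq_union] at hx
      simp only [mem_iUnion] at hx
      obtain ⟨t, hts, hind, hx⟩ := hx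
      have hcard : t.card ≤ Module.finrank ℝ V + 1 := by
        have h := hind.card_le_finrank_succ
        rw [Fintype.card_coe] at h
        exact h.trans (Nat.succ_le_succ (Submodule.finrank_le _))
      obtain ⟨w, hw0, hw1, hwx⟩ := Finset.mem_convexHull'.1 hx
      simp only [mem_iUnion]
      refine ⟨t.card, Finset.mem_range.2 (by omega),
        (fun i => w (t.equivFin.symm i), fun i => (t.equivFin.symm i : V)),
        ⟨⟨fun i => hw0 _ (t.equivFin.symm i).2, ?_⟩, fun i _ => hts (t.equivFin.symm i).2⟩, ?_⟩
      · rw [Equiv.sum_comp t.equivFin.symm (fun y : t => w y), Finset.sum_coe_sort t w, hw1]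
      · show ∑ i, w (t.equivFin.symm i) • (t.equivFin.symm i : V) = x
        rw [Equiv.sum_comp t.equivFin.symm (fun y : t => w y • (y : V)),
          Finset.sum_coe_sort t (fun y => w y • y), hwx]
    · refine iUnion₂_subset fun k _ => ?_
      rintro _ ⟨p, ⟨hp1, hp2⟩, rfl⟩
      exact (convex_convexHull ℝ s).sum_mem (fun i _ => hp1.1 i) hp1.2
        fun i _ => subset_convexHull ℝ s (hp2 i (mem_univ i))
  rw [key]
  refine Finset.isCompact_biUnion _ fun k _ => ?_
  refine ((isCompact_stdSimplex ℝ (Fin k)).prod (isCompact_univ_pi fun _ => hs)).image ?_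
  fun_prop

/-! ### Gradients of convex functions -/

section Convex

variable {V : Type*} [NormedAddCommGroup V] [InnerProductSpace ℝ V] [CompleteSpace V]
  {S : Set V} {φ : V → ℝ} {G : V → V}

theorem hasDerivAt_line {y g h : V} (hg : HasGradientAt φ g y) :
    HasDerivAt (fun t : ℝ => φ (y + t • h)) (inner ℝ g h) 0 := by
  have h1 : HasDerivAt (fun t : ℝ => y + t • h) h 0 := by
    simpa using ((hasDerivAt_id (0 : ℝ)).smul_const h).const_add y
  have h2 : HasFDerivAt φ (InnerProductSpace.toDual ℝ V g) (y + (0 : ℝ) • h) := by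
    simpa using hg.hasFDerivAt
  exact h2.comp_hasDerivAt (0 : ℝ) h1

theorem tendsto_slope_line {y g h : V} (hg : HasGradientAt φ g y) :
    Tendsto (fun t : ℝ => t⁻¹ * (φ (y + t • h) - φ y)) (𝓝[>] 0) (𝓝 (inner ℝ g h)) := by
  have := (hasDerivAt_line (h := h) hg).tendsto_slope_zero_right
  simpa using this

theorem gradient_ineq (hφ : ConvexOn ℝ S φ) {x y g : V} (hx : x ∈ S) (hy : y ∈ S)
    (hg : HasGradientAt φ g y) : φ y + inner ℝ g (x - y) ≤ φ x := by
  have h := le_of_tendsto (b := φ x - φ y) (tendsto_slope_line (h := x - y) hg) (by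
    filter_upwards [Ioo_mem_nhdsGT (zero_lt_one' ℝ)] with t ht
    have h1 := hφ.2 hy hx (sub_nonneg.2 ht.2.le) ht.1.le (by ring)
    have h2 : (1 - t) • y + t • x = y + t • (x - y) := by module
    rw [h2, smul_eq_mul, smul_eq_mul] at h1
    rw [inv_mul_le_iff₀ ht.1]
    linarith)
  linarith

theorem eq_gradient_of_subgradient {x g u : V} (hx : x ∈ interior S) (hg : HasGradientAt φ g x)
    (hu : ∀ y ∈ S, φ x + inner ℝ u (y - x) ≤ φ y) : u = g := by
  have hmin : IsLocalMin (fun y => φ y - inner ℝ u y) x := by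
    filter_upwards [mem_interior_iff_mem_nhds.1 hx] with y hy
    have := hu y hy
    rw [inner_sub_right] at this
    linarith
  have hd : HasFDerivAt (fun y => φ y - inner ℝ u y)
      (InnerProductSpace.toDual ℝ V g - InnerProductSpace.toDual ℝ V u) x :=
    hg.hasFDerivAt.sub (InnerProductSpace.toDual ℝ V u).hasFDerivAt
  have h0 := hmin.hasFDerivAt_eq_zero hd
  exact ((InnerProductSpace.toDual ℝ V).injective (sub_eq_zero.1 h0)).symm

variable [FiniteDimensional ℝ V]

/-- Near `x` the gradients are bounded by a local Lipschitz constant, and each of their cluster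
points is a subgradient at `x`, hence equal to `G x`. -/
theorem continuousOn_gradient (hφ : ConvexOn ℝ S φ)
    (hG : ∀ x ∈ interior S, HasGradientAt φ (G x) x) : ContinuousOn G (interior S) := by
  intro x hx
  have hcont := hφ.continuousOn_interior
  obtain ⟨K, W, hW, hLip⟩ := hφ.locallyLipschitzOn_interior hx
  rw [nhdsWithin_eq_nhds.2 (isOpen_interior.mem_nhds hx)] at hW
  rw [ContinuousWithinAt, nhdsWithin_eq_nhds.2 (isOpen_interior.mem_nhds hx)]
  refine (isCompact_closedBall (0 : V) K).tendsto_nhds_of_unique_mapClusterPt ?_ ?_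
  · filter_upwards [interior_mem_nhds.2 hW, isOpen_interior.mem_nhds hx] with y hyW hy
    have := (hG y hy).hasFDerivAt.le_of_lipschitzOn (mem_interior_iff_mem_nhds.1 hyW) hLip
    rw [LinearIsometryEquiv.norm_map] at this
    simpa using this
  · intro g _ hcl
    refine eq_gradient_of_subgradient hx (hG x hx) fun z hz => ?_
    obtain ⟨F, hF, hFg⟩ := mapClusterPt_iff_ultrafilter.1 hcl
    have h1 : Tendsto φ F (𝓝 (φ x)) :=
      ((hcont x hx).continuousAt (isOpen_interior.mem_nhds hx)).tendsto.mono_left hF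
    have h2 : Tendsto (fun y : V => z - y) F (𝓝 (z - x)) :=
      tendsto_const_nhds.sub (tendsto_id.mono_left hF)
    refine le_of_tendsto (h1.add (hFg.inner h2)) (hF ?_)
    filter_upwards [isOpen_interior.mem_nhds hx] with y hy
    exact gradient_ineq hφ hz (interior_subset hy) (hG y hy)

/-- Moving from a point of `S` near a boundary point `b` towards an interior point `c₀` decreases
`φ`, and every tilt of `φ` by a linear form of norm at most `B`, by a definite amount: the gradients
blow up at `b`, and they point outwards since `φ` is bounded above near `c₀`. -/
theorem exists_descent_near_frontier (hφ : ConvexOn ℝ S φ)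
    (hG : ∀ x ∈ interior S, HasGradientAt φ (G x) x) {b c₀ : V}
    (hb : Tendsto (fun x => ‖G x‖) (𝓝[interior S] b) atTop) (hc₀ : c₀ ∈ interior S)
    {B : ℝ} (hB : 0 ≤ B) :
    ∃ t > 0, ∀ᶠ x in 𝓝[S] b, ∃ y ∈ interior S, ∀ g : V, ‖g‖ ≤ B →
      φ y - inner ℝ g (y - x) ≤ φ x - t := by
  obtain ⟨r, hr, hrS⟩ := Metric.nhds_basis_closedBall.mem_iff.1 (isOpen_interior.mem_nhds hc₀)
  obtain ⟨K, hK⟩ := ((isCompact_closedBall c₀ r).image_of_continuousOn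
    (hφ.continuousOn_interior.mono hrS)).bddAbove
  set R := ‖c₀ - b‖ + 1 with hR
  have hR0 : 0 < R := by positivity
  obtain ⟨N, hN0, hN⟩ : ∃ N : ℝ, 0 < N ∧ K - φ c₀ + ‖G c₀‖ * R - r * N ≤ -(B * R + 1) := by
    refine ⟨max 1 ((K - φ c₀ + ‖G c₀‖ * R + B * R + 1) / r), by positivity, ?_⟩
    have := (div_le_iff₀' hr).1 (le_max_right 1 ((K - φ c₀ + ‖G c₀‖ * R + B * R + 1) / r))
    linarith
  obtain ⟨ε, hε, hεN⟩ := Metric.mem_nhdsWithin_iff.1 (hb.eventually_ge_atTop N)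
  set t := min (1 / 2) (ε / (2 * R)) with ht
  have ht0 : 0 < t := by positivity
  have ht1 : t ≤ 1 / 2 := min_le_left _ _
  have htR : t * R ≤ ε / 2 := by
    have := (le_div_iff₀ (by positivity)).1 (min_le_right (1 / 2) (ε / (2 * R)))
    linarith
  refine ⟨t, ht0, ?_⟩
  have hball : Metric.ball b (min 1 (ε / 2)) ∈ 𝓝[S] b :=
    mem_nhdsWithin_of_mem_nhds (Metric.ball_mem_nhds _ (by positivity))
  filter_upwards [hball, self_mem_nhdsWithin] with x hxb hxS
  rw [Metric.mem_ball, lt_min_iff, dist_eq_norm] at hxb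
  have hxR : ‖c₀ - x‖ ≤ R := by
    have : c₀ - x = (c₀ - b) - (x - b) := by abel
    rw [this]
    exact (norm_sub_le _ _).trans (by linarith [hxb.1])
  have hyS : x + t • (c₀ - x) ∈ interior S :=
    hφ.1.add_smul_sub_mem_interior hxS hc₀ ⟨ht0, by linarith⟩
  refine ⟨x + t • (c₀ - x), hyS, fun g hg => ?_⟩
  set y := x + t • (c₀ - x) with hy
  have hNy : N ≤ ‖G y‖ := by
    refine hεN ⟨?_, hyS⟩
    rw [Metric.mem_ball, dist_eq_norm]
    have : y - b = (x - b) + t • (c₀ - x) := by rw [hy]; abel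
    rw [this]
    refine (norm_add_le _ _).trans_lt ?_
    rw [norm_smul, Real.norm_of_nonneg ht0.le]
    nlinarith [mul_le_mul_of_nonneg_left hxR ht0.le]
  have hGy : 0 < ‖G y‖ := hN0.trans_le hNy
  -- The gradient inequality at `y`, tested at the point of the ball around `c₀` that lies in the
  -- direction of `G y`.
  have hin : inner ℝ (G y) (c₀ - y) ≤ K - φ y - r * ‖G y‖ := by
    have hzb : c₀ + (r / ‖G y‖) • G y ∈ Metric.closedBall c₀ r := by
      rw [Metric.mem_closedBall, dist_eq_norm, add_sub_cancel_left, norm_smul,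
        Real.norm_of_nonneg (by positivity), div_mul_cancel₀ _ hGy.ne']
    have h1 := gradient_ineq hφ (interior_subset (hrS hzb)) (interior_subset hyS) (hG y hyS)
    have h2 : φ (c₀ + (r / ‖G y‖) • G y) ≤ K := hK (mem_image_of_mem _ hzb)
    have h3 : c₀ + (r / ‖G y‖) • G y - y = (c₀ - y) + (r / ‖G y‖) • G y := by abel
    rw [h3, inner_add_right, inner_smul_right, real_inner_self_eq_norm_sq] at h1
    have h4 : r / ‖G y‖ * ‖G y‖ ^ 2 = r * ‖G y‖ := by field_simp
    linarith
  have hlow : φ c₀ - ‖G c₀‖ * R ≤ φ y := by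
    have h1 := gradient_ineq hφ (interior_subset hyS) (interior_subset hc₀) (hG c₀ hc₀)
    have h2 := neg_le_of_abs_le (abs_real_inner_le_norm (G c₀) (y - c₀))
    have h3 : ‖y - c₀‖ ≤ R := by
      have : y - c₀ = -((1 - t) • (c₀ - x)) := by rw [hy]; module
      rw [this, norm_neg, norm_smul, Real.norm_of_nonneg (by linarith)]
      nlinarith [norm_nonneg (c₀ - x)]
    nlinarith [norm_nonneg (G c₀)]
  have hs : inner ℝ (G y) (c₀ - y) ≤ -(B * R + 1) := by nlinarith
  have hcy : c₀ - y = (1 - t) • (c₀ - x) := by rw [hy]; module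
  have hxy : x - y = -(t • (c₀ - x)) := by rw [hy]; abel
  have hyx : y - x = t • (c₀ - x) := by rw [hy]; abel
  have hgr := gradient_ineq hφ hxS (interior_subset hyS) (hG y hyS)
  rw [hxy, inner_neg_right, inner_smul_right] at hgr
  rw [hcy, inner_smul_right] at hs
  rw [hyx, inner_smul_right]
  have hBR : 0 ≤ B * R := by positivity
  have hs' : inner ℝ (G y) (c₀ - x) ≤ -(B * R + 1) := by nlinarith
  have hgb : -(B * R) ≤ inner ℝ g (c₀ - x) := by
    have h1 := neg_le_of_abs_le (abs_real_inner_le_norm g (c₀ - x))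
    nlinarith [norm_nonneg g, norm_nonneg (c₀ - x)]
  nlinarith

/-- A function that is strictly convex near `c` grows at least linearly, away from `c`, above its
tangent plane at `c`. -/
theorem exists_linear_growth (hφ : ConvexOn ℝ S φ) (hst : StrictConvexOn ℝ (interior S) φ)
    {c g : V} (hc : c ∈ interior S) (hg : HasGradientAt φ g c) {r : ℝ} (hr : 0 < r) :
    ∃ δ > 0, ∀ y ∈ S, r ≤ ‖y - c‖ → δ * ‖y - c‖ ≤ φ y - φ c - inner ℝ g (y - c) := by
  obtain ⟨ρ', hρ', hρS'⟩ := Metric.nhds_basis_closedBall.mem_iff.1 (isOpen_interior.mem_nhds hc)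
  set ρ := min ρ' r with hρd
  have hρ : 0 < ρ := lt_min hρ' hr
  have hρS : Metric.closedBall c ρ ⊆ interior S :=
    (Metric.closedBall_subset_closedBall (min_le_left _ _)).trans hρS'
  have hsph : Metric.sphere c ρ ⊆ interior S := Metric.sphere_subset_closedBall.trans hρS
  have hpos : ∀ z ∈ Metric.sphere c ρ, 0 < φ z - φ c - inner ℝ g (z - c) := by
    intro z hz
    have hzc : z ≠ c := by
      rintro rfl
      simp [hρ.ne] at hz
    have h1 := hst.2 hc (hsph hz) hzc.symm (half_pos one_pos) (half_pos one_pos) (by norm_num)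
    have h2 : (1 / 2 : ℝ) • c + (1 / 2 : ℝ) • z = c + (1 / 2 : ℝ) • (z - c) := by module
    have hm : c + (1 / 2 : ℝ) • (z - c) ∈ interior S := by
      rw [← h2]
      exact hφ.1.interior hc (hsph hz) (by norm_num) (by norm_num) (by norm_num)
    have h3 := gradient_ineq hφ (interior_subset hm) (interior_subset hc) hg
    rw [add_sub_cancel_left, inner_smul_right] at h3
    rw [h2, smul_eq_mul, smul_eq_mul] at h1
    linarith
  obtain ⟨δ, hδ, hδs⟩ : ∃ δ > 0, ∀ z ∈ Metric.sphere c ρ,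
      δ ≤ φ z - φ c - inner ℝ g (z - c) := by
    have hcont : ContinuousOn (fun z => φ z - φ c - inner ℝ g (z - c)) (Metric.sphere c ρ) := by
      have := hφ.continuousOn_interior.mono hsph
      fun_prop
    rcases (Metric.sphere c ρ).eq_empty_or_nonempty with he | hne
    · exact ⟨1, one_pos, by simp [he]⟩
    · obtain ⟨z₀, hz₀, hmin⟩ := (isCompact_sphere c ρ).exists_isMinOn hne hcont
      exact ⟨_, hpos z₀ hz₀, fun z hz => hmin hz⟩
  refine ⟨δ / ρ, by positivity, fun y hy hry => ?_⟩
  have hny : 0 < ‖y - c‖ := hr.trans_le hry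
  set s := ρ / ‖y - c‖ with hs
  have hs0 : 0 < s := by positivity
  have hs1 : s ≤ 1 := (div_le_one hny).2 ((min_le_right _ _).trans hry)
  have hz : c + s • (y - c) ∈ Metric.sphere c ρ := by
    rw [mem_sphere_iff_norm, add_sub_cancel_left, norm_smul, Real.norm_of_nonneg hs0.le, hs,
      div_mul_cancel₀ _ hny.ne']
  have h1 := hδs _ hz
  have h2 := hφ.2 (interior_subset hc) hy (sub_nonneg.2 hs1) hs0.le (by ring)
  have h3 : (1 - s) • c + s • y = c + s • (y - c) := by module
  rw [h3, smul_eq_mul, smul_eq_mul] at h2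
  rw [add_sub_cancel_left, inner_smul_right] at h1
  have h4 : δ ≤ s * (φ y - φ c - inner ℝ g (y - c)) := by linarith
  have h5 : δ / ρ * ‖y - c‖ = δ / s := by rw [hs]; field_simp
  rw [h5, div_le_iff₀' hs0]
  exact h4

end Convex

variable {J : ℕ} {f : E J → EReal} {C : Set (E J)}

/-! ### Extended-real-valued functions and Legendre functions -/

theorem coe_re {g : E J → EReal} {x : E J} (hx : x ∈ dom g) : (re g x : EReal) = g x :=
  EReal.coe_toReal hx.2 hx.1

theorem mem_dom_of_le {g : E J → EReal} {x : E J} {a b : ℝ} (ha : (a : EReal) ≤ g x)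
    (hb : g x ≤ b) : x ∈ dom g ∧ a ≤ re g x ∧ re g x ≤ b := by
  have hx : x ∈ dom g := ⟨fun h => by simp [h] at ha, fun h => by simp [h] at hb⟩
  rw [← coe_re hx, EReal.coe_le_coe_iff] at ha hb
  exact ⟨hx, ha, hb⟩

theorem IsConvex.eq_top (hf : IsConvex f) {x : E J} (hx : x ∉ dom f) : f x = ⊤ := by
  by_contra h
  exact hx ⟨hf.ne_bot x, h⟩

theorem IsLegendre.hasGradientAt (hf : IsLegendre f) :
    ∀ x ∈ interior (dom f), HasGradientAt (re f) (grad f x) x :=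
  fun x hx => (hf.smooth.differentiable x hx).hasGradientAt

theorem IsLegendre.continuousOn_re (hf : IsLegendre f) :
    ContinuousOn (re f) (interior (dom f)) := hf.convex.convexOn.continuousOn_interior

theorem IsLegendre.continuousOn_grad (hf : IsLegendre f) :
    ContinuousOn (grad f) (interior (dom f)) :=
  continuousOn_gradient hf.convex.convexOn hf.hasGradientAt

theorem IsLegendre.strictConvexOn (hf : IsLegendre f) :
    StrictConvexOn ℝ (interior (dom f)) (re f) := by
  refine hf.strict _ (fun x hx => ⟨grad f x, interior_subset hx, fun h => ?_⟩)
    hf.convex.convexOn.1.interior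
  by_cases hxh : x + h ∈ dom f
  · rw [← coe_re hxh, ← coe_re (interior_subset hx), ← EReal.coe_add, EReal.coe_le_coe_iff]
    have := gradient_ineq hf.convex.convexOn hxh (interior_subset hx) (hf.hasGradientAt x hx)
    rwa [add_sub_cancel_left, real_inner_comm] at this
  · rw [hf.convex.eq_top hxh]
    exact le_top

theorem gradImage_eq_image (hf : IsLegendre f) {S : Set (E J)} (hS : S ⊆ interior (dom f)) :
    gradImage f S = grad f '' S := by
  ext v
  constructor
  · rintro ⟨u, hu, hui, hv⟩
    exact ⟨u, hu, (hf.hasGradientAt u hui).unique hv⟩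
  · rintro ⟨u, hu, rfl⟩
    exact ⟨u, hu, hS hu, hf.hasGradientAt u (hS hu)⟩

/-! ### The gradient of the conjugate inverts the gradient -/

theorem le_conj {x : E J} (hx : x ∈ dom f) (u : E J) :
    ((inner ℝ x u - re f x : ℝ) : EReal) ≤ conj f u := by
  rw [EReal.coe_sub, coe_re hx]
  exact le_iSup (fun x : E J => ((inner ℝ x u : ℝ) : EReal) - f x) x

theorem conj_le (hf : IsConvex f) {u : E J} {a : ℝ}
    (h : ∀ x ∈ dom f, inner ℝ x u - re f x ≤ a) : conj f u ≤ a := by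
  refine iSup_le fun x => ?_
  by_cases hx : x ∈ dom f
  · rw [← coe_re hx, ← EReal.coe_sub, EReal.coe_le_coe_iff]
    exact h x hx
  · rw [hf.eq_top hx, EReal.sub_top]
    exact bot_le

/-- The linear growth of `f` above its tangent plane at `x` gives
`0 ≤ f* (∇ f (x) + v) - f* (∇ f (x)) - ⟪x, v⟫ ≤ r * ‖v‖` for every `r > 0` and all small `v`. -/
theorem IsLegendre.hasGradientAt_conj (hf : IsLegendre f) {x : E J} (hx : x ∈ interior (dom f)) :
    grad f x ∈ interior (dom (conj f)) ∧ HasGradientAt (re (conj f)) x (grad f x) := by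
  set u := grad f x with hu
  have hxd := interior_subset hx
  have key : ∀ r > 0, ∃ δ > 0, ∀ v : E J, ‖v - u‖ ≤ δ → v ∈ dom (conj f) ∧
      inner ℝ x v - re f x ≤ re (conj f) v ∧
      re (conj f) v ≤ inner ℝ x v - re f x + r * ‖v - u‖ := by
    intro r hr
    obtain ⟨δ, hδ, h⟩ := exists_linear_growth hf.convex.convexOn hf.strictConvexOn hx
      (hf.hasGradientAt x hx) hr
    refine ⟨δ, hδ, fun v hv => mem_dom_of_le (le_conj hxd v) (conj_le hf.convex fun y hy => ?_)⟩
    have h1 : inner ℝ (y - x) (v - u) ≤ ‖y - x‖ * ‖v - u‖ := real_inner_le_norm _ _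
    have h2 : inner ℝ (y - x) (v - u) = inner ℝ y v - inner ℝ x v - inner ℝ u (y - x) := by
      rw [inner_sub_right, inner_sub_left, real_inner_comm u (y - x)]
    rcases le_total r ‖y - x‖ with hry | hry
    · have h3 := h y hy hry
      have h4 : ‖y - x‖ * ‖v - u‖ ≤ δ * ‖y - x‖ := by
        rw [mul_comm]
        gcongr
      have h5 : 0 ≤ r * ‖v - u‖ := by positivity
      linarith
    · have h3 := gradient_ineq hf.convex.convexOn hy hxd (hf.hasGradientAt x hx)
      have h4 : ‖y - x‖ * ‖v - u‖ ≤ r * ‖v - u‖ := by gcongr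
      linarith
  have hval : re (conj f) u = inner ℝ x u - re f x := by
    obtain ⟨δ, hδ, h⟩ := key 1 one_pos
    obtain ⟨-, h1, h2⟩ := h u (by simpa using hδ.le)
    rw [sub_self, norm_zero, mul_zero, add_zero] at h2
    exact le_antisymm h2 h1
  constructor
  · obtain ⟨δ, hδ, h⟩ := key 1 one_pos
    exact mem_interior_iff_mem_nhds.2 (mem_of_superset (Metric.closedBall_mem_nhds u hδ)
      fun v hv => (h v (mem_closedBall_iff_norm.1 hv)).1)
  · rw [hasGradientAt_iff_isLittleO, Asymptotics.isLittleO_iff]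
    intro r hr
    obtain ⟨δ, hδ, h⟩ := key r hr
    filter_upwards [Metric.closedBall_mem_nhds u hδ] with v hv
    obtain ⟨-, h1, h2⟩ := h v (mem_closedBall_iff_norm.1 hv)
    rw [hval, inner_sub_right, Real.norm_eq_abs, abs_le]
    constructor <;> linarith [mul_nonneg hr.le (norm_nonneg (v - u))]

/-- **Šmulian's criterion**: if `h` majorizes the affine functions `⟪y n, ·⟫ - a n` near `u`, is
differentiable at `u`, and is attained there in the limit, then `y n` converges to the gradient. -/
theorem tendsto_of_hasGradientAt {V : Type*} [NormedAddCommGroup V] [InnerProductSpace ℝ V]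
    [CompleteSpace V] {h : V → ℝ} {x u : V} (hx : HasGradientAt h x u) {y : ℕ → V} {a : ℕ → ℝ}
    (hle : ∀ᶠ v in 𝓝 u, ∀ n, inner ℝ (y n) v - a n ≤ h v)
    (hlim : Tendsto (fun n => inner ℝ (y n) u - a n) atTop (𝓝 (h u))) :
    Tendsto y atTop (𝓝 x) := by
  rw [Metric.tendsto_atTop']
  intro ε hε
  rw [hasGradientAt_iff_isLittleO, Asymptotics.isLittleO_iff] at hx
  obtain ⟨ρ, hρ, hball⟩ := Metric.nhds_basis_closedBall.mem_iff.1
    ((hx (half_pos (half_pos hε))).and hle)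
  have hev : ∀ᶠ n in atTop, h u - ε / 4 * ρ < inner ℝ (y n) u - a n :=
    hlim.eventually_const_lt (by nlinarith)
  obtain ⟨N, hN⟩ := eventually_atTop.1 hev
  refine ⟨N, fun n hn => ?_⟩
  rw [dist_eq_norm]
  by_contra! hcon
  have hny : 0 < ‖y n - x‖ := hε.trans_le hcon
  -- Test at distance `ρ` from `u` in the direction of `y n - x`.
  set v := u + (ρ / ‖y n - x‖) • (y n - x) with hv
  have hvu : v - u = (ρ / ‖y n - x‖) • (y n - x) := by rw [hv]; abel
  have hnorm : ‖v - u‖ = ρ := by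
    rw [hvu, norm_smul, Real.norm_of_nonneg (by positivity), div_mul_cancel₀ _ hny.ne']
  obtain ⟨h1, h2⟩ := hball (mem_closedBall_iff_norm.2 hnorm.le)
  have h3 := (le_abs_self _).trans h1
  have h4 := h2 n
  rw [hnorm] at h3
  have h5 : inner ℝ (y n - x) (v - u) = ρ * ‖y n - x‖ := by
    rw [hvu, inner_smul_right, real_inner_self_eq_norm_sq]
    field_simp
  have h6 : inner ℝ (y n - x) (v - u)
      = inner ℝ (y n) v - inner ℝ (y n) u - inner ℝ x (v - u) := by
    rw [inner_sub_left, inner_sub_right (y n)]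
  have h7 := hN n hn.le
  nlinarith

/-- A sequence maximizing `⟪·, u⟫ - f` converges to `∇ f* (u)` and cannot approach the
boundary of `dom f`. No lower semicontinuity of `f` is needed. -/
theorem IsLegendre.mem_interior_of_hasGradientAt_conj (hf : IsLegendre f)
    (hne : (interior (dom f)).Nonempty) {u x : E J} (hu : u ∈ interior (dom (conj f)))
    (hx : HasGradientAt (re (conj f)) x u) : x ∈ interior (dom f) ∧ u = grad f x := by
  have hle : ∀ v ∈ dom (conj f), ∀ y ∈ dom f, inner ℝ y v - re f y ≤ re (conj f) v := by
    intro v hv y hy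
    rw [← EReal.coe_le_coe_iff, coe_re hv]
    exact le_conj hy v
  have hud := interior_subset hu
  have hsup : ∀ n : ℕ, ∃ y ∈ dom f,
      re (conj f) u - 1 / ((n : ℝ) + 1) < inner ℝ y u - re f y := by
    intro n
    by_contra! h
    have h1 := conj_le hf.convex h
    rw [← coe_re hud, EReal.coe_le_coe_iff] at h1
    have : (0 : ℝ) < 1 / ((n : ℝ) + 1) := by positivity
    linarith
  choose y hyd hy using hsup
  have hlim : Tendsto (fun n => inner ℝ (y n) u - re f (y n)) atTop (𝓝 (re (conj f) u)) := by
    refine tendsto_of_tendsto_of_tendsto_of_le_of_le ?_ tendsto_const_nhds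
      (fun n => (hy n).le) (fun n => hle u hud _ (hyd n))
    simpa using (tendsto_const_nhds (x := re (conj f) u)).sub
      (tendsto_one_div_add_atTop_nhds_zero_nat (𝕜 := ℝ))
  have hyx : Tendsto y atTop (𝓝 x) := by
    refine tendsto_of_hasGradientAt hx ?_ hlim
    filter_upwards [mem_interior_iff_mem_nhds.1 hu] with v hv n
    exact hle v hv _ (hyd n)
  have hyx' : Tendsto y atTop (𝓝[dom f] x) :=
    tendsto_nhdsWithin_iff.2 ⟨hyx, Eventually.of_forall hyd⟩
  have hxi : x ∈ interior (dom f) := by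
    by_contra hxi
    have hfr : x ∈ frontier (dom f) :=
      ⟨mem_closure_of_tendsto hyx (Eventually.of_forall hyd), hxi⟩
    obtain ⟨c₀, hc₀⟩ := hne
    obtain ⟨t, ht, h⟩ := exists_descent_near_frontier hf.convex.convexOn hf.hasGradientAt
      (hf.smooth.blowup x hfr) hc₀ (norm_nonneg u)
    obtain ⟨n, hn1, hn2⟩ := ((hyx'.eventually h).and
      (hlim.eventually_const_lt (sub_lt_self _ ht))).exists
    obtain ⟨z, hz, hzu⟩ := hn1
    have h1 := hzu u le_rfl
    have h2 := hle u hud z (interior_subset hz)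
    rw [inner_sub_right, real_inner_comm, real_inner_comm (y n)] at h1
    linarith
  refine ⟨hxi, eq_gradient_of_subgradient hxi (hf.hasGradientAt x hxi) fun z hz => ?_⟩
  have hcont : Tendsto (re f) (𝓝 x) (𝓝 (re f x)) :=
    hf.continuousOn_re.continuousAt (isOpen_interior.mem_nhds hxi)
  have h1 : inner ℝ x u - re f x = re (conj f) u :=
    tendsto_nhds_unique ((hyx.inner tendsto_const_nhds).sub (hcont.comp hyx)) hlim
  have h2 := hle u hud z hz
  rw [inner_sub_right, real_inner_comm, real_inner_comm x]
  linarith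

/-! ### The Bregman distance and the farthest-distance function -/

/-- The Bregman distance as a real number; it agrees with `D f x c` for `x ∈ dom f` and
`c ∈ interior (dom f)`. -/
noncomputable def bregmanReal (f : E J → EReal) (x c : E J) : ℝ :=
  re f x - re f c - inner ℝ (grad f c) (x - c)

theorem D_eq_coe {x c : E J} (hx : x ∈ dom f) (hc : c ∈ interior (dom f)) :
    D f x c = bregmanReal f x c := by
  rw [D, if_pos hc, ← coe_re hx, ← coe_re (interior_subset hc), ← EReal.coe_sub, ← EReal.coe_sub,
    bregmanReal]

theorem IsConvex.D_eq_top (hf : IsConvex f) {x c : E J} (hx : x ∉ dom f)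
    (hc : c ∈ interior (dom f)) : D f x c = ⊤ := by
  rw [D, if_pos hc, hf.eq_top hx, ← coe_re (interior_subset hc), EReal.top_sub_coe,
    EReal.top_sub_coe]

theorem bregmanReal_sub (x y c : E J) :
    bregmanReal f y c - bregmanReal f x c = re f y - re f x - inner ℝ (grad f c) (y - x) := by
  simp only [bregmanReal, inner_sub_right]
  ring

theorem farDist_eq_top (hf : IsConvex f) (hne : C.Nonempty) (hCU : C ⊆ interior (dom f))
    {x : E J} (hx : x ∉ dom f) : farDist f C x = ⊤ := by
  obtain ⟨c, hc⟩ := hne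
  refine top_le_iff.1 ?_
  rw [← hf.D_eq_top hx (hCU hc)]
  exact le_iSup₂ (f := fun c (_ : c ∈ C) => D f x c) c hc

theorem IsLegendre.continuousOn_bregmanReal (hf : IsLegendre f) (x : E J) :
    ContinuousOn (bregmanReal f x) (interior (dom f)) := by
  have h1 := hf.continuousOn_re
  have h2 := hf.continuousOn_grad
  unfold bregmanReal
  fun_prop

theorem farDist_eq_coe (hf : IsLegendre f) (hne : C.Nonempty) (hCU : C ⊆ interior (dom f))
    (hC : IsCompact C) {x : E J} (hx : x ∈ dom f) :
    farDist f C x = re (farDist f C) x ∧ (∀ c ∈ C, bregmanReal f x c ≤ re (farDist f C) x) ∧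
      ∃ c ∈ C, bregmanReal f x c = re (farDist f C) x := by
  obtain ⟨c, hc, hmax⟩ := hC.exists_isMaxOn hne ((hf.continuousOn_bregmanReal x).mono hCU)
  have h : farDist f C x = bregmanReal f x c := by
    apply le_antisymm
    · refine iSup₂_le fun c' hc' => ?_
      rw [D_eq_coe hx (hCU hc'), EReal.coe_le_coe_iff]
      exact hmax hc'
    · rw [← D_eq_coe hx (hCU hc)]
      exact le_iSup₂ (f := fun c (_ : c ∈ C) => D f x c) c hc
  have h' : re (farDist f C) x = bregmanReal f x c := by rw [re, h, EReal.toReal_coe]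
  rw [h']
  exact ⟨h, fun c' hc' => hmax hc', c, hc, rfl⟩

theorem mem_farPts_iff (hf : IsLegendre f) (hne : C.Nonempty) (hCU : C ⊆ interior (dom f))
    (hC : IsCompact C) {x c : E J} :
    c ∈ farPts f C x ↔ x ∈ dom f ∧ c ∈ C ∧ bregmanReal f x c = re (farDist f C) x := by
  refine and_congr_right fun hx => and_congr_right fun hc => ?_
  rw [D_eq_coe hx (hCU hc), (farDist_eq_coe hf hne hCU hC hx).1, EReal.coe_eq_coe_iff]

theorem mem_argmin_iff (hf : IsLegendre f) (hne : C.Nonempty) (hCU : C ⊆ interior (dom f))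
    (hC : IsCompact C) {x : E J} : x ∈ argmin (farDist f C) ↔
      x ∈ dom f ∧ ∀ y ∈ dom f, re (farDist f C) x ≤ re (farDist f C) y := by
  have key := fun {x : E J} (hx : x ∈ dom f) => (farDist_eq_coe hf hne hCU hC hx).1
  constructor
  · intro h
    have hx : x ∈ dom f := by
      by_contra hx
      obtain ⟨c, hc⟩ := hne
      have h1 := h c
      rw [farDist_eq_top hf.convex ⟨c, hc⟩ hCU hx, key (interior_subset (hCU hc))] at h1
      exact EReal.coe_ne_top _ (top_le_iff.1 h1)
    refine ⟨hx, fun y hy => ?_⟩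
    have h1 := h y
    rwa [key hx, key hy, EReal.coe_le_coe_iff] at h1
  · rintro ⟨hx, h⟩ y
    by_cases hy : y ∈ dom f
    · rw [key hx, key hy, EReal.coe_le_coe_iff]
      exact h y hy
    · rw [farDist_eq_top hf.convex hne hCU hy]
      exact le_top

/-! ### Existence, uniqueness and location of the Chebyshev center -/

/-- The farthest-distance function stays a definite amount above its infimum near a boundary
point, because the gradients of `f` are bounded on the compact set `C`. -/
theorem exists_farDist_descent (hf : IsLegendre f) (hne : C.Nonempty)
    (hCU : C ⊆ interior (dom f)) (hC : IsCompact C) {b : E J} (hb : b ∈ frontier (dom f)) :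
    ∃ t > 0, ∀ᶠ x in 𝓝[dom f] b, ∃ y ∈ dom f,
      re (farDist f C) y ≤ re (farDist f C) x - t := by
  obtain ⟨c₀, hc₀⟩ := id hne
  obtain ⟨B, hB⟩ := hC.exists_bound_of_continuousOn (hf.continuousOn_grad.mono hCU)
  obtain ⟨t, ht, h⟩ := exists_descent_near_frontier hf.convex.convexOn hf.hasGradientAt
    (hf.smooth.blowup b hb) (hCU hc₀) ((norm_nonneg _).trans (hB c₀ hc₀))
  refine ⟨t, ht, ?_⟩
  filter_upwards [h, self_mem_nhdsWithin] with x ⟨y, hy, hyx⟩ hx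
  refine ⟨y, interior_subset hy, ?_⟩
  obtain ⟨c, hc, hcy⟩ := (farDist_eq_coe hf hne hCU hC (interior_subset hy)).2.2
  have h1 := (farDist_eq_coe hf hne hCU hC hx).2.1 c hc
  have h2 := hyx _ (hB c hc)
  have h3 := bregmanReal_sub (f := f) x y c
  linarith

theorem argmin_farDist_subset (hf : IsLegendre f) (hne : C.Nonempty)
    (hCU : C ⊆ interior (dom f)) (hC : IsCompact C) :
    argmin (farDist f C) ⊆ interior (dom f) := by
  intro x hx
  obtain ⟨hxd, hmin⟩ := (mem_argmin_iff hf hne hCU hC).1 hx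
  by_contra hxi
  obtain ⟨t, ht, h⟩ := exists_farDist_descent hf hne hCU hC ⟨subset_closure hxd, hxi⟩
  obtain ⟨y, hy, hyx⟩ := h.self_of_nhdsWithin hxd
  linarith [hmin y hy]

theorem exists_mem_argmin_farDist (hf : IsLegendre f) (hne : C.Nonempty)
    (hCU : C ⊆ interior (dom f)) (hC : IsCompact C) : ∃ x, x ∈ argmin (farDist f C) := by
  have key := fun {x : E J} (hx : x ∈ dom f) => (farDist_eq_coe hf hne hCU hC hx).2
  obtain ⟨c₀, hc₀⟩ := id hne
  have hc₀d := interior_subset (hCU hc₀)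
  have hbdd : BddBelow (re (farDist f C) '' dom f) := by
    refine ⟨0, ?_⟩
    rintro _ ⟨x, hx, rfl⟩
    have h1 := gradient_ineq hf.convex.convexOn hx hc₀d (hf.hasGradientAt c₀ (hCU hc₀))
    have h2 := (key hx).1 c₀ hc₀
    rw [bregmanReal] at h2
    linarith
  obtain ⟨s, -, hs, hsm⟩ := exists_seq_tendsto_sInf (Nonempty.image _ ⟨c₀, hc₀d⟩) hbdd
  set m := sInf (re (farDist f C) '' dom f) with hm
  choose x hxd hxs using hsm
  have hxm : Tendsto (fun n => re (farDist f C) (x n)) atTop (𝓝 m) := by simpa only [hxs] using hs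
  have hmle : ∀ y ∈ dom f, m ≤ re (farDist f C) y := fun y hy =>
    csInf_le hbdd (mem_image_of_mem _ hy)
  obtain ⟨δ, hδ, hgrow⟩ := exists_linear_growth hf.convex.convexOn hf.strictConvexOn (hCU hc₀)
    (hf.hasGradientAt c₀ (hCU hc₀)) one_pos
  obtain ⟨M, hM⟩ := hxm.bddAbove_range
  have hball : ∀ n, x n ∈ Metric.closedBall c₀ (max 1 (M / δ)) := by
    intro n
    rw [mem_closedBall_iff_norm, le_max_iff]
    rcases le_total ‖x n - c₀‖ 1 with h | h
    · exact Or.inl h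
    · right
      have h1 := hgrow _ (hxd n) h
      have h2 := (key (hxd n)).1 c₀ hc₀
      have h3 : re (farDist f C) (x n) ≤ M := hM (mem_range_self n)
      rw [bregmanReal] at h2
      rw [le_div_iff₀' hδ]
      linarith
  obtain ⟨z, -, k, hk, hz⟩ := (isCompact_closedBall c₀ (max 1 (M / δ))).tendsto_subseq hball
  have hmk := hxm.comp hk.tendsto_atTop
  have hzi : z ∈ interior (dom f) := by
    by_contra hzi
    have hzf : z ∈ frontier (dom f) :=
      ⟨mem_closure_of_tendsto hz (Eventually.of_forall fun n => hxd (k n)), hzi⟩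
    obtain ⟨t, ht, h⟩ := exists_farDist_descent hf hne hCU hC hzf
    have hz' : Tendsto (x ∘ k) atTop (𝓝[dom f] z) :=
      tendsto_nhdsWithin_iff.2 ⟨hz, Eventually.of_forall fun n => hxd (k n)⟩
    obtain ⟨n, ⟨y, hy, hyn⟩, hn⟩ := ((hz'.eventually h).and
      (hmk.eventually_lt_const (lt_add_of_pos_right m ht))).exists
    have := hmle y hy
    simp only [Function.comp_apply] at hn hyn
    linarith
  have hzd := interior_subset hzi
  refine ⟨z, (mem_argmin_iff hf hne hCU hC).2 ⟨hzd, fun y hy => le_trans ?_ (hmle y hy)⟩⟩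
  obtain ⟨c, hc, hcz⟩ := (key hzd).2
  rw [← hcz]
  have hcont : Tendsto (re f) (𝓝 z) (𝓝 (re f z)) :=
    hf.continuousOn_re.continuousAt (isOpen_interior.mem_nhds hzi)
  exact le_of_tendsto_of_tendsto'
    (((hcont.comp hz).sub_const _).sub (tendsto_const_nhds.inner (hz.sub_const c))) hmk
    fun n => (key (hxd (k n))).1 c hc

theorem argmin_farDist_unique (hf : IsLegendre f) (hne : C.Nonempty)
    (hCU : C ⊆ interior (dom f)) (hC : IsCompact C) {x y : E J}
    (hx : x ∈ argmin (farDist f C)) (hy : y ∈ argmin (farDist f C)) : x = y := by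
  by_contra hxy
  have hxi := argmin_farDist_subset hf hne hCU hC hx
  have hyi := argmin_farDist_subset hf hne hCU hC hy
  obtain ⟨hxd, hxm⟩ := (mem_argmin_iff hf hne hCU hC).1 hx
  obtain ⟨hyd, hym⟩ := (mem_argmin_iff hf hne hCU hC).1 hy
  set z := (1 / 2 : ℝ) • x + (1 / 2 : ℝ) • y with hz
  have hzd : z ∈ dom f := hf.convex.convexOn.1 hxd hyd (by norm_num) (by norm_num) (by norm_num)
  obtain ⟨c, hc, hcz⟩ := (farDist_eq_coe hf hne hCU hC hzd).2.2
  have h1 := (farDist_eq_coe hf hne hCU hC hxd).2.1 c hc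
  have h2 := (farDist_eq_coe hf hne hCU hC hyd).2.1 c hc
  have h3 := hf.strictConvexOn.2 hxi hyi hxy (half_pos one_pos) (half_pos one_pos) (by norm_num)
  rw [← hz, smul_eq_mul, smul_eq_mul] at h3
  have h4 : inner ℝ (grad f c) z
      = 1 / 2 * inner ℝ (grad f c) x + 1 / 2 * inner ℝ (grad f c) y := by
    rw [hz, inner_add_right, inner_smul_right, inner_smul_right]
  have h5 := hxm y hyd
  have h6 := hxm z hzd
  have h7 := hym x hxd
  simp only [bregmanReal, inner_sub_right] at h1 h2 hcz
  linarith

/-! ### Characterization of the Chebyshev center -/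

theorem farPts_subset (hCU : C ⊆ interior (dom f)) (x : E J) :
    farPts f C x ⊆ interior (dom f) := fun _ hc => hCU hc.2.1

/-- If `∇ f (x)` were outside the hull, some direction `h` would separate
them, and a small step from `x` along `h` would decrease the distance to every point of `C` that is
nearly farthest from `x`. -/
theorem grad_mem_convexHull (hf : IsLegendre f) (hne : C.Nonempty)
    (hCU : C ⊆ interior (dom f)) (hC : IsCompact C) {x : E J}
    (hx : x ∈ argmin (farDist f C)) :
    grad f x ∈ convexHull ℝ (grad f '' farPts f C x) := by
  have hxi := argmin_farDist_subset hf hne hCU hC hx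
  obtain ⟨hxd, hmin⟩ := (mem_argmin_iff hf hne hCU hC).1 hx
  have key := fun {x : E J} (hx : x ∈ dom f) => (farDist_eq_coe hf hne hCU hC hx).2
  have hPhi : IsCompact (farPts f C x) := by
    have : farPts f C x = C ∩ bregmanReal f x ⁻¹' {re (farDist f C) x} := by
      ext c
      rw [mem_farPts_iff hf hne hCU hC]
      exact and_iff_right hxd
    rw [this]
    exact hC.of_isClosed_subset (((hf.continuousOn_bregmanReal x).mono
      hCU).preimage_isClosed_of_isClosed hC.isClosed isClosed_singleton) inter_subset_left
  have hK := isCompact_convexHull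
    (hPhi.image_of_continuousOn (hf.continuousOn_grad.mono (farPts_subset hCU x)))
  by_contra hnot
  obtain ⟨l, s, hl1, hl2⟩ := geometric_hahn_banach_point_closed (convex_convexHull ℝ _)
    hK.isClosed hnot
  obtain ⟨h, rfl⟩ := (InnerProductSpace.toDual ℝ (E J)).surjective l
  simp only [InnerProductSpace.toDual_apply_apply] at hl1 hl2
  have hline : Tendsto (fun t : ℝ => x + t • h) (𝓝[>] 0) (𝓝 x) := by
    have : Tendsto (fun t : ℝ => x + t • h) (𝓝 0) (𝓝 (x + (0 : ℝ) • h)) :=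
      Continuous.tendsto (by fun_prop) 0
    rw [zero_smul, add_zero] at this
    exact this.mono_left nhdsWithin_le_nhds
  have hsel : ∀ t : ℝ, ∃ c ∈ C, x + t • h ∈ dom f →
      bregmanReal f (x + t • h) c = re (farDist f C) (x + t • h) := by
    intro t
    by_cases ht : x + t • h ∈ dom f
    · obtain ⟨c, hc, hct⟩ := (key ht).2
      exact ⟨c, hc, fun _ => hct⟩
    · obtain ⟨c, hc⟩ := hne
      exact ⟨c, hc, fun h => absurd h ht⟩
  choose c hcC hc using hsel
  -- A cluster point `c₀` of farthest points from `x + t • h`, as `t` decreases to `0`.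
  obtain ⟨F, hF⟩ := exists_ultrafilter_le (𝓝[>] (0 : ℝ))
  obtain ⟨c₀, hc₀, hlim⟩ := hC.ultrafilter_le_nhds (F.map c)
    (le_principal_iff.2 (Filter.mem_map.2 (Eventually.of_forall hcC)))
  have hcF : Tendsto c F (𝓝 c₀) := hlim
  have hgF : Tendsto (fun t => grad f (c t)) F (𝓝 (grad f c₀)) :=
    (hf.continuousOn_grad.continuousAt (isOpen_interior.mem_nhds (hCU hc₀))).tendsto.comp hcF
  have hfc : Tendsto (fun t => re f (c t)) F (𝓝 (re f c₀)) :=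
    (hf.continuousOn_re.continuousAt (isOpen_interior.mem_nhds (hCU hc₀))).tendsto.comp hcF
  have hxF : Tendsto (fun t : ℝ => x + t • h) F (𝓝 x) := hline.mono_left hF
  have hfx : Tendsto (fun t : ℝ => re f (x + t • h)) F (𝓝 (re f x)) :=
    (hf.continuousOn_re.continuousAt (isOpen_interior.mem_nhds hxi)).tendsto.comp hxF
  have hdom : ∀ᶠ t : ℝ in 𝓝[>] 0, x + t • h ∈ dom f :=
    hline (mem_interior_iff_mem_nhds.1 hxi)
  have hfar : re (farDist f C) x ≤ bregmanReal f x c₀ := by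
    refine ge_of_tendsto ((hfx.sub hfc).sub (hgF.inner (hxF.sub hcF))) (hF ?_)
    filter_upwards [hdom] with t ht
    exact (hmin _ ht).trans_eq (hc t ht).symm
  have hmem : c₀ ∈ farPts f C x :=
    (mem_farPts_iff hf hne hCU hC).2 ⟨hxd, hc₀, le_antisymm ((key hxd).1 c₀ hc₀) hfar⟩
  have hdir : inner ℝ (grad f c₀) h ≤ inner ℝ (grad f x) h := by
    refine le_of_tendsto_of_tendsto (hgF.inner tendsto_const_nhds)
      ((tendsto_slope_line (hf.hasGradientAt x hxi)).mono_left hF) (hF ?_)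
    filter_upwards [hdom, self_mem_nhdsWithin] with t ht ht0
    have h1 := (hmin _ ht).trans_eq (hc t ht).symm
    have h2 := (key hxd).1 (c t) (hcC t)
    have h3 := bregmanReal_sub (f := f) x (x + t • h) (c t)
    rw [add_sub_cancel_left, inner_smul_right] at h3
    rw [le_inv_mul_iff₀ ht0]
    linarith
  have h1 := hl2 _ (subset_convexHull ℝ _ (mem_image_of_mem (grad f) hmem))
  rw [real_inner_comm] at hl1 h1
  linarith

/-- Each `D (·, c)` with `c` farthest from `x` minorizes the farthest-distance function and equals it
at `x`; a suitable convex combination of them is minimal at `x`. -/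
theorem mem_argmin_of_grad_mem_convexHull (hf : IsLegendre f) (hne : C.Nonempty)
    (hCU : C ⊆ interior (dom f)) (hC : IsCompact C) {x : E J} (hx : x ∈ interior (dom f))
    (hmem : grad f x ∈ convexHull ℝ (grad f '' farPts f C x)) : x ∈ argmin (farDist f C) := by
  have hxd := interior_subset hx
  refine (mem_argmin_iff hf hne hCU hC).2 ⟨hxd, fun y hy => ?_⟩
  -- For fixed `y`, this is a half-space of vectors `v` that contains the gradients of `f` at the
  -- farthest points from `x`, hence also `∇ f (x)`.
  have hsub : convexHull ℝ (grad f '' farPts f C x) ⊆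
      {v | re f y - re f x - (re (farDist f C) y - re (farDist f C) x) ≤ inner ℝ v (y - x)} := by
    refine convexHull_min ?_ (convex_halfSpace_ge
      (f := fun v : E J => inner ℝ v (y - x)) ?_ _)
    · rintro _ ⟨c, hc, rfl⟩
      obtain ⟨-, hcC, hcx⟩ := (mem_farPts_iff hf hne hCU hC).1 hc
      have h1 := (farDist_eq_coe hf hne hCU hC hy).2.1 c hcC
      have h2 := bregmanReal_sub (f := f) x y c
      simp only [mem_ofPred_eq]
      linarith
    · exact ⟨fun a b => inner_add_left _ _ _, fun a b => by
        rw [inner_smul_left]; rfl⟩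
  have h1 := hsub hmem
  have h2 := gradient_ineq hf.convex.convexOn hy hxd (hf.hasGradientAt x hx)
  simp only [mem_ofPred_eq] at h1
  linarith

end Bregman

theorem theoremt {J : ℕ} (f : Bregman.E J → EReal) (hf : Bregman.IsLegendre f)
    (C : Set (Bregman.E J)) (hC_ne : C.Nonempty) (hCU : C ⊆ interior (Bregman.dom f))
    (hC : IsCompact C) :
    (∃! x, x ∈ Bregman.argmin (Bregman.farDist f C)) ∧
    Bregman.argmin (Bregman.farDist f C) ⊆ interior (Bregman.dom f) ∧
    ∀ x : Bregman.E J, x ∈ Bregman.argmin (Bregman.farDist f C) ↔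
      x ∈ Bregman.gradImage (Bregman.conj f)
        (convexHull ℝ (Bregman.gradImage f (Bregman.farPts f C x))) := by
  have hsub := Bregman.argmin_farDist_subset hf hC_ne hCU hC
  refine ⟨?_, hsub, fun x => ?_⟩
  · obtain ⟨x, hx⟩ := Bregman.exists_mem_argmin_farDist hf hC_ne hCU hC
    exact ⟨x, hx, fun y hy => Bregman.argmin_farDist_unique hf hC_ne hCU hC hy hx⟩
  · rw [Bregman.gradImage_eq_image hf (Bregman.farPts_subset hCU x)]
    constructor
    · intro hx
      exact ⟨Bregman.grad f x, Bregman.grad_mem_convexHull hf hC_ne hCU hC hx,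
        hf.hasGradientAt_conj (hsub hx)⟩
    · rintro ⟨u, hu, hui, hux⟩
      obtain ⟨hxi, rfl⟩ := hf.mem_interior_of_hasGradientAt_conj (hC_ne.mono hCU) hui hux
      exact Bregman.mem_argmin_of_grad_mem_convexHull hf hC_ne hCU hC hxi hu
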